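/- Let $[a,b]\subset\mathbb{R}$ be a finite interval ($a<b$), let $n\in\mathbb{N}\cup\{0\}$, $m,r,l\in\mathbb{N}$ (positive integers) and $1\le p\le\infty$. For an integer $N\ge1$ let $$W_p^N=W_p^N([a,b];\mathbb{C})=\{y\in C^{N-1}([a,b];\mathbb{C}) : y^{(N-1)}\text{ is absolutely continuous on }[a,b],\ y^{(N)}\in L_p[a,b]\},$$ and $W_p^0=L_p([a,b];\mathbb{C})$, with the norm $\|y\|_{N,p}=\sum_{k=0}^{N}\|y^{(k)}\|_p$; the norm of a vector-valued function is the sum of the norms of its components. Given matrix-valued functions $A_0,\dots,A_{r-1}\in(W_p^n)^{m\times m}$ and a continuous linear operator $B\colon(W_p^{n+r})^m\to\mathbb{C}^l$, put $$(Ly)(t)=y^{(r)}(t)+\sum_{j=1}^{r}A_{r-j}(t)\,y^{(r-j)}(t),$$ and consider the bounded linear operator $$(L,B)\colon(W_p^{n+r})^m\to(W_p^n)^m\times\mathbb{C}^l,\qquad y\mapsto(Ly,By).$$ For each $k\in\mathbb{N}$ let $A_0(\cdot,k),\dots,A_{r-1}(\cdot,k)\in(W_p^n)^{m\times m}$ and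 a continuous linear operator $B(k)\colon(W_p^{n+r})^m\to\mathbb{C}^l$ be given, and let $(L(k),B(k))$ be the corresponding operator on the same pair of spaces. Suppose that $(L(k),B(k))$ converges strongly to $(L,B)$ as $k\to\infty$, i.e. $(L(k)y,B(k)y)\to(Ly,By)$ in $(W_p^n)^m\times\mathbb{C}^l$ for every $y\in(W_p^{n+r})^m$. If the operator $(L,B)$ is invertible (a bijection with bounded inverse), then the operators $(L(k),B(k))$ are invertible for all sufficiently large $k$. -/

import Mathlib

open Set Filter Topology MeasureTheory
open scoped ENNReal

noncomputable section

/-- `y : ℝ → ℂ` (only its values on `[a,b]` matter) represents an element of the complex Sobolev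
space `W_p^N([a,b])`. For `N = 0` this means `y ∈ L_p[a,b]`; for `N = M + 1` it means that
`y ∈ C^M[a,b]`, that `y^(M)` is absolutely continuous on `[a,b]`, and that its (a.e. defined)
derivative `y^(M+1)` is in `L_p[a,b]`. -/
def MemSobolev (N : ℕ) (p : ℝ≥0∞) (a b : ℝ) (y : ℝ → ℂ) : Prop :=
  match N with
  | 0 => MemLp y p (volume.restrict (Icc a b))
  | M + 1 => ContDiffOn ℝ M y (Icc a b) ∧
      AbsolutelyContinuousOnInterval (iteratedDerivWithin M y (Icc a b)) a b ∧
      MemLp (iteratedDerivWithin (M + 1) y (Icc a b)) p (volume.restrict (Icc a b))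

namespace MemSobolev

variable {N : ℕ} {p : ℝ≥0∞} {a b : ℝ}

theorem ac_congr {f g : ℝ → ℂ} (hab : a < b) (hf : AbsolutelyContinuousOnInterval f a b)
    (h : EqOn f g (Icc a b)) : AbsolutelyContinuousOnInterval g a b := by
  rw [absolutelyContinuousOnInterval_iff] at hf ⊢
  intro ε hε
  obtain ⟨δ, hδ, H⟩ := hf ε hε
  refine ⟨δ, hδ, fun E hE hs => ?_⟩
  have := H E hE hs
  rw [← uIcc_of_le hab.le] at h
  convert! this using 1
  refine Finset.sum_congr rfl fun i hi => ?_
  rw [h (hE.1 i hi).1, h (hE.1 i hi).2]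

theorem ac_continuousOn {f : ℝ → ℂ} (hab : a < b) (hf : AbsolutelyContinuousOnInterval f a b) :
    ContinuousOn f (Icc a b) := by
  simpa [uIcc_of_le hab.le] using hf.continuousOn

theorem ac_ae_diff {f : ℝ → ℂ} (hab : a < b) (hf : AbsolutelyContinuousOnInterval f a b) :
    ∀ᵐ t ∂(volume.restrict (Icc a b)), DifferentiableWithinAt ℝ f (Icc a b) t := by
  have := hf.boundedVariationOn
  rw [uIcc_of_le hab.le] at this
  exact this.locallyBoundedVariationOn.ae_differentiableWithinAt measurableSet_Icc

theorem memLp_of_continuousOn {f : ℝ → ℂ} (hf : ContinuousOn f (Icc a b)) :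
    MemLp f p (volume.restrict (Icc a b)) := by
  obtain ⟨C, hC⟩ := isCompact_Icc.exists_bound_of_continuousOn hf
  refine MemLp.of_bound (hf.aestronglyMeasurable measurableSet_Icc) C ?_
  filter_upwards [ae_restrict_mem measurableSet_Icc] with t ht using hC t ht

theorem ae_of_eqOn {f g : ℝ → ℂ} (h : EqOn f g (Icc a b)) :
    f =ᵐ[volume.restrict (Icc a b)] g := by
  filter_upwards [ae_restrict_mem measurableSet_Icc] with t ht using h ht

theorem continuousOn {y : ℝ → ℂ} (hy : MemSobolev (N + 1) p a b y) :
    ContinuousOn y (Icc a b) :=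
  hy.1.continuousOn

theorem congr {y z : ℝ → ℂ} (hab : a < b) (hy : MemSobolev N p a b y)
    (h : y =ᵐ[volume.restrict (Icc a b)] z) (h' : 0 < N → EqOn y z (Icc a b)) :
    MemSobolev N p a b z := by
  cases N with
  | zero => exact (memLp_congr_ae h).1 hy
  | succ M =>
    have h := h' M.succ_pos
    exact ⟨hy.1.congr h.symm, ac_congr hab hy.2.1 (iteratedDerivWithin_congr h),
      (memLp_congr_ae (ae_of_eqOn (iteratedDerivWithin_congr h))).1 hy.2.2⟩

theorem succ_iff {y : ℝ → ℂ} (hab : a < b) :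
    MemSobolev (N + 1) p a b y ↔ AbsolutelyContinuousOnInterval y a b ∧
      (0 < N → DifferentiableOn ℝ y (Icc a b)) ∧
      MemSobolev N p a b (derivWithin y (Icc a b)) := by
  cases N with
  | zero =>
    simp only [MemSobolev, iteratedDerivWithin_zero, zero_add, iteratedDerivWithin_one]
    constructor
    · rintro ⟨-, h, h'⟩
      exact ⟨h, fun h => absurd h (lt_irrefl _), h'⟩
    · rintro ⟨h, -, h'⟩
      exact ⟨by simpa using ac_continuousOn hab h, h, h'⟩
  | succ M =>
    have key : ContDiffOn ℝ ((M + 1 : ℕ)) y (Icc a b) ↔ DifferentiableOn ℝ y (Icc a b) ∧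
        ContDiffOn ℝ M (derivWithin y (Icc a b)) (Icc a b) := by
      have := contDiffOn_succ_iff_derivWithin (𝕜 := ℝ) (f := y) (n := (M : WithTop ℕ∞))
        (uniqueDiffOn_Icc hab)
      simpa using this
    simp only [MemSobolev]
    rw [key, iteratedDerivWithin_succ' (n := M), iteratedDerivWithin_succ' (n := M + 1)]
    constructor
    · rintro ⟨⟨h1, h2⟩, h3, h4⟩
      refine ⟨?_, fun _ => h1, h2, h3, h4⟩
      apply ContDiffOn.absolutelyContinuousOnInterval
      rw [uIcc_of_le hab.le]
      exact (key.2 ⟨h1, h2⟩).of_le (by exact_mod_cast Nat.succ_le_succ (Nat.zero_le M))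
    · rintro ⟨-, h1, h2, h3, h4⟩
      exact ⟨⟨h1 M.succ_pos, h2⟩, h3, h4⟩

theorem mono {y : ℝ → ℂ} (hab : a < b) (hy : MemSobolev (N + 1) p a b y) :
    MemSobolev N p a b y := by
  induction N generalizing y with
  | zero => exact memLp_of_continuousOn (hy.continuousOn)
  | succ N ih =>
    rw [succ_iff hab] at hy ⊢
    exact ⟨hy.1, fun _ => hy.2.1 N.succ_pos, ih hy.2.2⟩

theorem mono' {k : ℕ} {y : ℝ → ℂ} (hab : a < b) (hy : MemSobolev (N + k) p a b y) :
    MemSobolev N p a b y := by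
  induction k with
  | zero => exact hy
  | succ k ih => exact ih (mono hab hy)

theorem iter {k : ℕ} {y : ℝ → ℂ} (hab : a < b) (hy : MemSobolev (N + k) p a b y) :
    MemSobolev N p a b (iteratedDerivWithin k y (Icc a b)) := by
  induction k generalizing y with
  | zero => simpa using hy
  | succ k ih =>
    rw [iteratedDerivWithin_succ']
    exact ih ((succ_iff hab).1 hy).2.2

theorem memLp_iter {k : ℕ} {y : ℝ → ℂ} (hab : a < b) (hk : k ≤ N) (hy : MemSobolev N p a b y) :
    MemLp (iteratedDerivWithin k y (Icc a b)) p (volume.restrict (Icc a b)) := by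
  obtain ⟨j, rfl⟩ := Nat.exists_eq_add_of_le' hk
  have h0 : MemSobolev (0 + j) p a b (iteratedDerivWithin k y (Icc a b)) := by
    rw [zero_add]; exact iter hab hy
  exact mono' hab h0

theorem memLp {y : ℝ → ℂ} (hab : a < b) (hy : MemSobolev N p a b y) :
    MemLp y p (volume.restrict (Icc a b)) := by
  simpa using hy.memLp_iter hab (Nat.zero_le N)

theorem iter_congr {k : ℕ} {y z : ℝ → ℂ} (hab : a < b) (hk : k ≤ N) (hy : MemSobolev N p a b y)
    (hz : MemSobolev N p a b z) (h : y =ᵐ[volume.restrict (Icc a b)] z) :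
    iteratedDerivWithin k y (Icc a b) =ᵐ[volume.restrict (Icc a b)]
      iteratedDerivWithin k z (Icc a b) := by
  cases N with
  | zero =>
    obtain rfl : k = 0 := by omega
    simpa using h
  | succ M =>
    exact ae_of_eqOn (iteratedDerivWithin_congr
      (Measure.eqOn_Icc_of_ae_eq volume hab.ne h (hy.continuousOn) (hz.continuousOn)))

theorem iter_add {k : ℕ} {y z : ℝ → ℂ} (hab : a < b) (hk : k ≤ N) (hy : MemSobolev N p a b y)
    (hz : MemSobolev N p a b z) :
    iteratedDerivWithin k (y + z) (Icc a b) =ᵐ[volume.restrict (Icc a b)]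
        iteratedDerivWithin k y (Icc a b) + iteratedDerivWithin k z (Icc a b) := by
  have hU := uniqueDiffOn_Icc hab
  cases N with
  | zero =>
    obtain rfl : k = 0 := by omega
    simp
  | succ M =>
    have hlt : ∀ j ≤ M, EqOn (iteratedDerivWithin j (y + z) (Icc a b))
        (iteratedDerivWithin j y (Icc a b) + iteratedDerivWithin j z (Icc a b)) (Icc a b) := by
      intro j hj t ht
      have hj' : (j : WithTop ℕ∞) ≤ M := by exact_mod_cast hj
      exact iteratedDerivWithin_add ht hU ((hy.1 t ht).of_le hj') ((hz.1 t ht).of_le hj')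
    rcases Nat.lt_or_ge M k with h | h
    · obtain rfl : k = M + 1 := by omega
      filter_upwards [ae_restrict_mem measurableSet_Icc, ac_ae_diff hab hy.2.1,
        ac_ae_diff hab hz.2.1] with t ht h1 h2
      rw [iteratedDerivWithin_succ, derivWithin_congr (hlt M le_rfl) (hlt M le_rfl ht),
        derivWithin_add h1 h2, Pi.add_apply, iteratedDerivWithin_succ, iteratedDerivWithin_succ]
    · exact ae_of_eqOn (hlt k h)

theorem add {y z : ℝ → ℂ} (hab : a < b) (hy : MemSobolev N p a b y) (hz : MemSobolev N p a b z) :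
    MemSobolev N p a b (y + z) := by
  have hadd := iter_add hab le_rfl hy hz
  cases N with
  | zero => exact MemLp.add hy hz
  | succ M =>
    refine ⟨hy.1.add hz.1, ac_congr hab (hy.2.1.add hz.2.1) ?_,
      (memLp_congr_ae hadd).2 (hy.2.2.add hz.2.2)⟩
    intro t ht
    exact (iteratedDerivWithin_add ht (uniqueDiffOn_Icc hab) (hy.1 t ht) (hz.1 t ht)).symm

theorem iter_smul {k : ℕ} (c : ℂ) (y : ℝ → ℂ) :
    iteratedDerivWithin k (c • y) (Icc a b) = c • iteratedDerivWithin k y (Icc a b) := by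
  ext t
  exact iteratedDerivWithin_const_smul_field c y

theorem smul {y : ℝ → ℂ} (c : ℂ) (hy : MemSobolev N p a b y) : MemSobolev N p a b (c • y) := by
  cases N with
  | zero => exact MemLp.const_smul hy c
  | succ M =>
    refine ⟨hy.1.const_smul c, ?_, ?_⟩
    · rw [iter_smul]; exact hy.2.1.const_smul c
    · rw [iter_smul]; exact hy.2.2.const_smul c

theorem zero (hab : a < b) : MemSobolev N p a b 0 := by
  induction N with
  | zero => exact MemLp.zero
  | succ N ih =>
    rw [succ_iff hab]
    refine ⟨?_, fun _ => differentiableOn_const 0, ?_⟩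
    · exact (contDiffOn_const (c := (0 : ℂ))).absolutelyContinuousOnInterval
    · have : derivWithin (0 : ℝ → ℂ) (Icc a b) = 0 := by
        exact derivWithin_const (Icc a b) (0 : ℂ)
      rwa [this]

theorem sum {ι : Type*} (s : Finset ι) {f : ι → ℝ → ℂ} (hab : a < b)
    (h : ∀ i ∈ s, MemSobolev N p a b (f i)) : MemSobolev N p a b (∑ i ∈ s, f i) :=
  Finset.sum_induction f (MemSobolev N p a b) (fun _ _ => add hab) (zero hab) h

/-- `W_p^n · W_p^(n+1) ⊆ W_p^n`. -/
theorem mul {u v : ℝ → ℂ} (hab : a < b) (hu : MemSobolev N p a b u)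
    (hv : MemSobolev (N + 1) p a b v) : MemSobolev N p a b (u * v) := by
  induction N generalizing u v with
  | zero =>
    have hc := hv.continuousOn
    obtain ⟨C, hC⟩ := isCompact_Icc.exists_bound_of_continuousOn hc
    have : MemLp v ∞ (volume.restrict (Icc a b)) := memLp_of_continuousOn hc
    exact this.mul (r := p) hu
  | succ N ih =>
    have hv' := (succ_iff hab).1 hv
    have hu' := (succ_iff hab).1 hu
    have e : ∀ t ∈ Icc a b, DifferentiableWithinAt ℝ u (Icc a b) t →
        derivWithin (u * v) (Icc a b) t =
        (derivWithin u (Icc a b) * v + derivWithin v (Icc a b) * u) t := by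
      intro t ht h
      rw [derivWithin_mul h (hv'.2.1 N.succ_pos t ht)]
      simp [mul_comm]
    refine (succ_iff hab).2 ⟨hu'.1.smul hv'.1, fun hN => (hu'.2.1 hN).mul (hv'.2.1 N.succ_pos), ?_⟩
    refine congr hab (add hab (ih hu'.2.2 (mono hab hv)) (ih (mono hab hv'.2.2) hu)) ?_ ?_
    · filter_upwards [ae_restrict_mem measurableSet_Icc, ac_ae_diff hab hu'.1] with t ht h
      exact (e t ht h).symm
    · exact fun hN t ht => (e t ht (hu'.2.1 hN t ht)).symm

end MemSobolev

/-- The linear space of classes (modulo a.e. equality on `[a,b]`) of functions in `W_p^N([a,b])`. -/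
def sobolevSubmodule (N : ℕ) (p : ℝ≥0∞) (a b : ℝ) [h : Fact (a < b)] :
    Submodule ℂ (Lp ℂ p (volume.restrict (Icc a b))) where
  carrier := {u | ∃ y : ℝ → ℂ, MemSobolev N p a b y ∧ u =ᵐ[volume.restrict (Icc a b)] y}
  zero_mem' := ⟨0, MemSobolev.zero h.out, Lp.coeFn_zero _ _ _⟩
  add_mem' := by
    rintro u v ⟨y, hy, hu⟩ ⟨z, hz, hv⟩
    exact ⟨y + z, hy.add h.out hz, (Lp.coeFn_add u v).trans (hu.add hv)⟩
  smul_mem' := by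
    rintro c u ⟨y, hy, hu⟩
    exact ⟨c • y, hy.smul c, (Lp.coeFn_smul c u).trans (hu.const_smul c)⟩

/-- The complex Sobolev space `W_p^N([a,b]; ℂ)`. It is a type of its own because its norm is not
the one inherited from `L_p`. -/
def SobolevSpace (N : ℕ) (p : ℝ≥0∞) (a b : ℝ) [Fact (a < b)] : Type :=
  sobolevSubmodule N p a b

namespace SobolevSpace

variable {N : ℕ} {p : ℝ≥0∞} {a b : ℝ} [hab : Fact (a < b)]

instance : AddCommGroup (SobolevSpace N p a b) :=
  inferInstanceAs (AddCommGroup (sobolevSubmodule N p a b))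

instance : Module ℂ (SobolevSpace N p a b) :=
  inferInstanceAs (Module ℂ (sobolevSubmodule N p a b))

/-- The `L_p` class underlying an element of the Sobolev space. -/
def toLp (u : SobolevSpace N p a b) : Lp ℂ p (volume.restrict (Icc a b)) := u.1

/-- A representative of `u` on `[a,b]`. On `[a,b]` it is unique (the continuous one)
if `N ≥ 1`; if `N = 0`, it is unique up to a.e. equality. -/
def rep (u : SobolevSpace N p a b) : ℝ → ℂ := Classical.choose u.2

/-- The derivative `u^(k)` on `[a,b]`, for `k ≤ N` (defined a.e. if `k = N`). -/
def deriv (u : SobolevSpace N p a b) (k : ℕ) : ℝ → ℂ :=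
  iteratedDerivWithin k u.rep (Icc a b)

/-- The element of the Sobolev space represented by a function. -/
def mk (y : ℝ → ℂ) (hy : MemSobolev N p a b y) : SobolevSpace N p a b :=
  ⟨MemLp.toLp y (hy.memLp hab.out), y, hy,
    MemLp.coeFn_toLp (hy.memLp hab.out)⟩

theorem memSobolev_rep (u : SobolevSpace N p a b) : MemSobolev N p a b u.rep :=
  (Classical.choose_spec u.2).1

theorem toLp_ae_eq_rep (u : SobolevSpace N p a b) :
    u.toLp =ᵐ[volume.restrict (Icc a b)] u.rep :=
  (Classical.choose_spec u.2).2

theorem ext_ae {u v : SobolevSpace N p a b} (h : u.rep =ᵐ[volume.restrict (Icc a b)] v.rep) :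
    u = v :=
  Subtype.ext (Lp.ext (u.toLp_ae_eq_rep.trans (h.trans v.toLp_ae_eq_rep.symm)))

theorem rep_mk (y : ℝ → ℂ) (hy : MemSobolev N p a b y) :
    (mk y hy).rep =ᵐ[volume.restrict (Icc a b)] y :=
  (mk y hy).toLp_ae_eq_rep.symm.trans (MemLp.coeFn_toLp (hy.memLp hab.out))

theorem rep_add (u v : SobolevSpace N p a b) :
    (u + v).rep =ᵐ[volume.restrict (Icc a b)] u.rep + v.rep :=
  (u + v).toLp_ae_eq_rep.symm.trans
    ((Lp.coeFn_add u.toLp v.toLp).trans (u.toLp_ae_eq_rep.add v.toLp_ae_eq_rep))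

theorem rep_smul (c : ℂ) (u : SobolevSpace N p a b) :
    (c • u).rep =ᵐ[volume.restrict (Icc a b)] c • u.rep :=
  (c • u).toLp_ae_eq_rep.symm.trans
    ((Lp.coeFn_smul c u.toLp).trans (u.toLp_ae_eq_rep.const_smul c))

theorem deriv_add (u v : SobolevSpace N p a b) {k : ℕ} (hk : k ≤ N) :
    (u + v).deriv k =ᵐ[volume.restrict (Icc a b)] u.deriv k + v.deriv k :=
  (MemSobolev.iter_congr hab.out hk (u + v).memSobolev_rep
    (u.memSobolev_rep.add hab.out v.memSobolev_rep) (rep_add u v)).trans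
    (MemSobolev.iter_add hab.out hk u.memSobolev_rep v.memSobolev_rep)

theorem deriv_smul (c : ℂ) (u : SobolevSpace N p a b) {k : ℕ} (hk : k ≤ N) :
    (c • u).deriv k =ᵐ[volume.restrict (Icc a b)] c • u.deriv k := by
  have := MemSobolev.iter_congr hab.out hk (c • u).memSobolev_rep
    (u.memSobolev_rep.smul c) (rep_smul c u)
  rwa [MemSobolev.iter_smul] at this

theorem memLp_deriv (u : SobolevSpace N p a b) {k : ℕ} (hk : k ≤ N) :
    MemLp (u.deriv k) p (volume.restrict (Icc a b)) :=
  u.memSobolev_rep.memLp_iter hab.out hk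

/-- The norm `‖u‖_{N,p} = ∑_{k=0}^N ‖u^(k)‖_p`. -/
instance : Norm (SobolevSpace N p a b) where
  norm u := ∑ k ∈ Finset.range (N + 1), (eLpNorm (u.deriv k) p (volume.restrict (Icc a b))).toReal

theorem norm_def (u : SobolevSpace N p a b) : ‖u‖ =
    ∑ k ∈ Finset.range (N + 1), (eLpNorm (u.deriv k) p (volume.restrict (Icc a b))).toReal := rfl

theorem normedSpaceCore [hp : Fact (1 ≤ p)] : NormedSpace.Core ℂ (SobolevSpace N p a b) where
  norm_nonneg u := Finset.sum_nonneg fun _ _ => ENNReal.toReal_nonneg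
  norm_smul c u := by
    simp only [norm_def, Finset.mul_sum]
    refine Finset.sum_congr rfl fun k hk => ?_
    have hk : k ≤ N := Nat.lt_succ_iff.1 (Finset.mem_range.1 hk)
    rw [eLpNorm_congr_ae (deriv_smul c u hk), eLpNorm_const_smul]
    simp
  norm_triangle u v := by
    simp only [norm_def, ← Finset.sum_add_distrib]
    refine Finset.sum_le_sum fun k hk => ?_
    have hk : k ≤ N := Nat.lt_succ_iff.1 (Finset.mem_range.1 hk)
    have hu := u.memLp_deriv hk
    have hv := v.memLp_deriv hk
    rw [eLpNorm_congr_ae (deriv_add u v hk), ← ENNReal.toReal_add hu.2.ne hv.2.ne]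
    exact ENNReal.toReal_mono (ENNReal.add_ne_top.2 ⟨hu.2.ne, hv.2.ne⟩)
      (eLpNorm_add_le hu.1 hv.1 hp.out)
  norm_eq_zero_iff u := by
    have hp0 : p ≠ 0 := (zero_lt_one.trans_le hp.out).ne'
    constructor
    · intro h
      rw [norm_def, Finset.sum_eq_zero_iff_of_nonneg fun _ _ => ENNReal.toReal_nonneg] at h
      have h0 := h 0 (by simp)
      have hu := u.memLp_deriv (Nat.zero_le N)
      rw [ENNReal.toReal_eq_zero_iff, or_iff_left hu.2.ne, eLpNorm_eq_zero_iff hu.1 hp0] at h0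
      have h1 : u.rep =ᵐ[volume.restrict (Icc a b)] 0 := by simpa [deriv] using h0
      have h2 : (0 : SobolevSpace N p a b).rep =ᵐ[volume.restrict (Icc a b)] 0 := by
        simpa using rep_smul 0 (0 : SobolevSpace N p a b)
      exact ext_ae (h1.trans h2.symm)
    · rintro rfl
      refine Finset.sum_eq_zero fun k hk => ?_
      have hk : k ≤ N := Nat.lt_succ_iff.1 (Finset.mem_range.1 hk)
      have := deriv_smul 0 (0 : SobolevSpace N p a b) hk
      rw [smul_zero, zero_smul] at this
      rw [eLpNorm_congr_ae this]
      simp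

instance [Fact (1 ≤ p)] : NormedAddCommGroup (SobolevSpace N p a b) :=
  NormedAddCommGroup.ofCore normedSpaceCore

instance [Fact (1 ≤ p)] : NormedSpace ℂ (SobolevSpace N p a b) :=
  NormedSpace.ofCore normedSpaceCore

end SobolevSpace

/-- The space `(W_p^N)^m` of vector-valued functions whose `m` components are in `W_p^N([a,b]; ℂ)`;
its norm is the sum of the norms of the components. -/
abbrev SobolevVec (N : ℕ) (p : ℝ≥0∞) (a b : ℝ) [Fact (a < b)] (m : ℕ) : Type :=
  PiLp 1 (fun _ : Fin m => SobolevSpace N p a b)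

section BoundaryValueProblem

variable {n r m l : ℕ} {p : ℝ≥0∞} {a b : ℝ} [hab : Fact (a < b)]

/-- The `i`-th component of `y^(r)(t) + ∑_{j=0}^{r-1} A_j(t) y^(j)(t)`. -/
def diffExpr (A : Fin r → Matrix (Fin m) (Fin m) (SobolevSpace n p a b))
    (y : SobolevVec (n + r) p a b m) (i : Fin m) (t : ℝ) : ℂ :=
  (y i).deriv r t + ∑ j : Fin r, ∑ q : Fin m, (A j i q).rep t * (y q).deriv j t

theorem memSobolev_diffExpr (A : Fin r → Matrix (Fin m) (Fin m) (SobolevSpace n p a b))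
    (y : SobolevVec (n + r) p a b m) (i : Fin m) : MemSobolev n p a b (diffExpr A y i) := by
  have e : diffExpr A y i = (y i).deriv r + ∑ j : Fin r, ∑ q : Fin m,
      (A j i q).rep * (y q).deriv j := by
    ext t; simp [diffExpr]
  rw [e]
  refine MemSobolev.add hab.out (MemSobolev.iter hab.out (y i).memSobolev_rep)
    (MemSobolev.sum _ hab.out fun j _ => MemSobolev.sum _ hab.out fun q _ =>
      MemSobolev.mul hab.out (A j i q).memSobolev_rep ?_)
  obtain ⟨s, hs⟩ := Nat.exists_eq_add_of_lt j.2
  have h := (y q).memSobolev_rep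
  have h1 : MemSobolev (n + 1 + s + j) p a b (y q).rep := by
    convert! h using 1
    omega
  exact MemSobolev.mono' hab.out (MemSobolev.iter hab.out h1)

variable [Fact (1 ≤ p)]

/-- The operator `L : (W_p^(n+r))^m → (W_p^n)^m`,
`(L y)(t) = y^(r)(t) + ∑_{j=0}^{r-1} A_j(t) y^(j)(t)`. -/
def diffOp (A : Fin r → Matrix (Fin m) (Fin m) (SobolevSpace n p a b)) :
    SobolevVec (n + r) p a b m →ₗ[ℂ] SobolevVec n p a b m where
  toFun y := WithLp.toLp 1 fun i => SobolevSpace.mk (diffExpr A y i) (memSobolev_diffExpr A y i)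
  map_add' y z := by
    ext i
    have hy := SobolevSpace.rep_mk _ (memSobolev_diffExpr A y i)
    have hz := SobolevSpace.rep_mk _ (memSobolev_diffExpr A z i)
    refine SobolevSpace.ext_ae ((SobolevSpace.rep_mk _ (memSobolev_diffExpr A (y + z) i)).trans
      (EventuallyEq.trans ?_ ((SobolevSpace.rep_add _ _).trans (hy.add hz)).symm))
    have h1 : ∀ᵐ t ∂(volume.restrict (Icc a b)), ∀ j : Fin r, ∀ q : Fin m,
        (y q + z q).deriv j t = (y q).deriv j t + (z q).deriv j t :=
      ae_all_iff.2 fun j => ae_all_iff.2 fun q => SobolevSpace.deriv_add (y q) (z q) (by omega)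
    filter_upwards [h1, SobolevSpace.deriv_add (y i) (z i) (k := r) (by omega)] with t h1 h2
    simp only [diffExpr, PiLp.add_apply, Pi.add_apply] at h1 h2 ⊢
    simp only [h1, h2, mul_add, Finset.sum_add_distrib]
    ring
  map_smul' c y := by
    ext i
    have hy := SobolevSpace.rep_mk _ (memSobolev_diffExpr A y i)
    refine SobolevSpace.ext_ae ((SobolevSpace.rep_mk _ (memSobolev_diffExpr A (c • y) i)).trans
      (EventuallyEq.trans ?_ ((SobolevSpace.rep_smul c _).trans (hy.const_smul c)).symm))
    have h1 : ∀ᵐ t ∂(volume.restrict (Icc a b)), ∀ j : Fin r, ∀ q : Fin m,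
        (c • y q).deriv j t = c * (y q).deriv j t :=
      ae_all_iff.2 fun j => ae_all_iff.2 fun q => SobolevSpace.deriv_smul c (y q) (by omega)
    filter_upwards [h1, SobolevSpace.deriv_smul c (y i) (k := r) (by omega)] with t h1 h2
    simp only [diffExpr, PiLp.smul_apply, Pi.smul_apply, smul_eq_mul] at h1 h2 ⊢
    simp only [h1, h2, mul_add, Finset.mul_sum]
    simp only [mul_left_comm]

/-- The operator `(L,B) : (W_p^(n+r))^m → (W_p^n)^m × ℂ^l`, `y ↦ (L y, B y)`, of the
boundary-value problem with the coefficients `A` and the boundary operator `B`. -/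
def bvpOp (A : Fin r → Matrix (Fin m) (Fin m) (SobolevSpace n p a b))
    (B : SobolevVec (n + r) p a b m →L[ℂ] EuclideanSpace ℂ (Fin l)) :
    SobolevVec (n + r) p a b m →ₗ[ℂ] SobolevVec n p a b m × EuclideanSpace ℂ (Fin l) :=
  (diffOp A).prod B.toLinearMap

end BoundaryValueProblem

/-- A linear operator between normed spaces is (boundedly) invertible: it is a bijection, bounded
together with its inverse. -/
def IsBoundedlyInvertible {E F : Type*} [NormedAddCommGroup E] [NormedSpace ℂ E]
    [NormedAddCommGroup F] [NormedSpace ℂ F] (T : E →ₗ[ℂ] F) : Prop :=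
  ∃ e : E ≃L[ℂ] F, ∀ x, e x = T x

/-- Strong convergence of a sequence of linear operators between normed spaces. -/
def StronglyConverges {E F : Type*} [NormedAddCommGroup E] [NormedSpace ℂ E]
    [NormedAddCommGroup F] [NormedSpace ℂ F] (T : ℕ → E →ₗ[ℂ] F) (T₀ : E →ₗ[ℂ] F) : Prop :=
  ∀ x, Tendsto (fun k => T k x) atTop (𝓝 (T₀ x))

end

/-!
The proof compares `(L(k), B(k))` with the intermediate operators `(L(k), B)`.

Strong convergence of the differential parts is automatically norm convergence: testing `L(k)` on the
vector functions `t ^ j e_q` recovers the coefficients one after another, so `A_j(k) → A_j` in `W_p^n`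
(`tendsto_coeff_of_tendsto_diffOpL`), and `L` depends continuously, in operator norm, on its
coefficients (`continuous_diffOpL`), because the product `W_p^n × W_p^(n+1) → W_p^n` is bounded
(`SobolevSpace.exists_norm_mul_le`). Hence `(L(k), B) → (L, B)` in norm, and `(L(k), B)` is invertible
for large `k`, with inverses `R(k)` that converge in norm.

Strong convergence of `B(k)` is not norm convergence, but `B(k)` takes values in `ℂ^l`. In terms of
`R(k)`, the operator `(L(k), B(k)) R(k)` is block triangular on `(W_p^n)^m × ℂ^l`, with the identity
in one diagonal block and `c ↦ B(k) R(k) (0, c)` in the other. By Banach–Steinhaus these maps converge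
pointwise to `c ↦ B R (0, c) = c`, with `R` the inverse of `(L, B)`; on the finite-dimensional space
`ℂ^l` this is norm convergence, so they are invertible for large `k`
(`eventually_isBoundedlyInvertible_prod`).

Banach–Steinhaus, the open mapping theorem and inversion need the Sobolev spaces to be complete. This
follows by induction on the order, since `u ↦ (u(a), u')` is an isomorphism of `W_p^(N+1)` onto
`ℂ × W_p^N`; the fundamental theorem of calculus for absolutely continuous functions provides the
bound, and integration the surjectivity.
-/

noncomputable section

/-! ### Perturbation of invertible operators onto a product with a finite-dimensional factor -/

section Perturbation

variable {E F G : Type*} [NormedAddCommGroup E] [NormedSpace ℂ E] [NormedAddCommGroup F]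
  [NormedSpace ℂ F] [NormedAddCommGroup G] [NormedSpace ℂ G]

/-- Joint continuity of evaluation along a strongly convergent sequence: by Banach–Steinhaus the
norms of the operators are bounded. -/
theorem tendsto_apply_of_strongly_tendsto [CompleteSpace E] {T : ℕ → E →L[ℂ] G} {T₀ : E →L[ℂ] G}
    (hT : ∀ x, Tendsto (fun k => T k x) atTop (𝓝 (T₀ x))) {u : ℕ → E} {x : E}
    (hu : Tendsto u atTop (𝓝 x)) : Tendsto (fun k => T k (u k)) atTop (𝓝 (T₀ x)) := by
  obtain ⟨C, hC⟩ : ∃ C, ∀ k, ‖T k‖ ≤ C := banach_steinhaus fun y => by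
    obtain ⟨C, hC⟩ := (hT y).norm.bddAbove_range
    exact ⟨C, fun k => hC ⟨k, rfl⟩⟩
  have h0 : Tendsto (fun k => C * ‖u k - x‖) atTop (𝓝 0) := by
    simpa using (tendsto_iff_norm_sub_tendsto_zero.1 hu).const_mul C
  have h1 : Tendsto (fun k => T k (u k - x)) atTop (𝓝 0) :=
    squeeze_zero_norm (fun k => (T k).le_of_opNorm_le (hC k) _) h0
  simpa using h1.add (hT x)

/-- On a finite-dimensional space, strong convergence implies norm convergence. -/
theorem tendsto_of_forall_tendsto_apply [FiniteDimensional ℂ G] {T : ℕ → G →L[ℂ] F}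
    {T₀ : G →L[ℂ] F} (h : ∀ c, Tendsto (fun k => T k c) atTop (𝓝 (T₀ c))) :
    Tendsto T atTop (𝓝 T₀) := by
  let e : (G →L[ℂ] F) ≃L[ℂ] Fin (Module.finrank ℂ G) → F :=
    ((ContinuousLinearEquiv.ofFinrankEq (Module.finrank_fin_fun ℂ).symm).arrowCongr
      (1 : F ≃L[ℂ] F)).trans (ContinuousLinearEquiv.piRing _)
  rw [e.toHomeomorph.isInducing.tendsto_nhds_iff]
  exact tendsto_pi_nhds.2 fun i => h _

/-- If `L k → L` in operator norm, `B k → B` only strongly, and `B` takes values in a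
finite-dimensional space, then invertibility of `(L, B)` passes to `(L k, B k)` for large `k`. -/
theorem eventually_isBoundedlyInvertible_prod [CompleteSpace E] [CompleteSpace F]
    [FiniteDimensional ℂ G] {L : E →L[ℂ] F} {Lk : ℕ → E →L[ℂ] F} {B : E →L[ℂ] G}
    {Bk : ℕ → E →L[ℂ] G} (hL : Tendsto Lk atTop (𝓝 L))
    (hB : ∀ x, Tendsto (fun k => Bk k x) atTop (𝓝 (B x))) (e : E ≃L[ℂ] F × G)
    (he : (e : E →L[ℂ] F × G) = L.prod B) :
    ∀ᶠ k in atTop, IsBoundedlyInvertible ((Lk k).prod (Bk k) : E →ₗ[ℂ] F × G) := by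
  have : CompleteSpace G := FiniteDimensional.complete ℂ G
  -- The auxiliary operators `(L k, B)` converge in norm, so they are invertible for large `k`.
  have hP : Tendsto (fun k => (Lk k).prod B) atTop (𝓝 (e : E →L[ℂ] F × G)) := by
    rw [he]
    exact ((ContinuousLinearMap.prodₗᵢ ℂ :
      (E →L[ℂ] F) × (E →L[ℂ] G) ≃ₗᵢ[ℂ] E →L[ℂ] F × G).continuous.tendsto (L, B)).comp
      (hL.prodMk_nhds tendsto_const_nhds)
  have hPinv : Tendsto (fun k => ((Lk k).prod B).inverse) atTop
      (𝓝 (e.symm : F × G →L[ℂ] E)) := by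
    have := (contDiffAt_map_inverse (n := 0) e).continuousAt.tendsto.comp hP
    rwa [ContinuousLinearMap.inverse_equiv] at this
  -- The corner operators `c ↦ B k ((L k, B)⁻¹ (0, c))` converge to the identity, in norm since `G`
  -- has finite dimension.
  let D : ℕ → G →L[ℂ] G := fun k =>
    Bk k ∘L (((Lk k).prod B).inverse ∘L ContinuousLinearMap.inr ℂ F G)
  have hD : Tendsto D atTop (𝓝 (ContinuousLinearMap.id ℂ G)) := by
    refine tendsto_of_forall_tendsto_apply fun c => ?_
    have h1 : Tendsto (fun k => ((Lk k).prod B).inverse (0, c)) atTop (𝓝 (e.symm (0, c))) :=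
      ((ContinuousLinearMap.apply ℂ E ((0, c) : F × G)).continuous.tendsto _).comp hPinv
    have h2 : B (e.symm (0, c)) = c := by
      have : (e : E →L[ℂ] F × G) (e.symm (0, c)) = (0, c) := e.apply_symm_apply _
      rw [he] at this
      exact congrArg Prod.snd this
    have := tendsto_apply_of_strongly_tendsto hB h1
    rw [h2] at this
    simpa [D] using this
  filter_upwards [hP.eventually e.nhds,
    hD.eventually (ContinuousLinearEquiv.refl ℂ G).nhds] with k ⟨P, hPk⟩ ⟨d, hdk⟩
  have hPapp : ∀ x, P x = (Lk k x, B x) := fun x => by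
    have := congrArg (fun T : E →L[ℂ] F × G => T x) hPk
    simpa using this
  have hd : ∀ c, d c = Bk k (P.symm (0, c)) := fun c => by
    have := congrArg (fun T : G →L[ℂ] G => T c) hdk
    simpa [D, ← hPk] using this
  have hLP : ∀ z, Lk k (P.symm z) = z.1 := fun z => by
    have := hPapp (P.symm z)
    rw [P.apply_symm_apply] at this
    exact (congrArg Prod.fst this).symm
  -- With `P = (L k, B)` and `d` the corner operator, `(L k, B k) P⁻¹` is block triangular with
  -- diagonal blocks `1` and `d`.
  refine ⟨ContinuousLinearEquiv.ofBijective ((Lk k).prod (Bk k)) ?_ ?_, fun x => rfl⟩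
  · refine LinearMap.ker_eq_bot'.2 fun x hx => ?_
    obtain ⟨h1, h2⟩ : Lk k x = 0 ∧ Bk k x = 0 := by simpa using hx
    have hx' : x = P.symm (0, B x) := by rw [← h1, ← hPapp, P.symm_apply_apply]
    have h3 : d (B x) = 0 := by rw [hd, ← hx', h2]
    rw [hx', (map_eq_zero_iff d d.injective).1 h3, ← Prod.zero_eq_mk, map_zero]
  · refine LinearMap.range_eq_top.2 fun z => ?_
    refine ⟨P.symm (z.1, 0) + P.symm (0, d.symm (z.2 - Bk k (P.symm (z.1, 0)))), ?_⟩
    ext1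
    · simp [hLP]
    · simp [← hd]

end Perturbation

/-! ### Primitives of complex functions -/

section Primitive

variable {a b : ℝ}

/-- An indefinite integral of a complex function is absolutely continuous. Mathlib has this for real
functions; the complex case is reduced to the real and imaginary parts. -/
theorem absolutelyContinuousOnInterval_integral_complex {g : ℝ → ℂ}
    (hg : IntervalIntegrable g volume a b) :
    AbsolutelyContinuousOnInterval (fun t => ∫ s in a..t, g s) a b := by
  have hre : IntervalIntegrable (fun s => (g s).re) volume a b := ⟨hg.1.re, hg.2.re⟩
  have him : IntervalIntegrable (fun s => (g s).im) volume a b := ⟨hg.1.im, hg.2.im⟩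
  have hconst : ∀ c : ℂ, AbsolutelyContinuousOnInterval (fun _ : ℝ => c) a b := fun c =>
    (contDiffOn_const (c := c)).absolutelyContinuousOnInterval
  have h := ((hre.absolutelyContinuousOnInterval_intervalIntegral left_mem_uIcc).smul
    (hconst 1)).add ((him.absolutelyContinuousOnInterval_intervalIntegral left_mem_uIcc).smul
    (hconst Complex.I))
  rw [absolutelyContinuousOnInterval_iff] at h ⊢
  intro ε hε
  obtain ⟨δ, hδ, H⟩ := h ε hε
  refine ⟨δ, hδ, fun E hE hs => ?_⟩
  have key : ∀ t ∈ uIcc a b, ∫ s in a..t, g s = (∫ s in a..t, (g s).re) • (1 : ℂ) +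
      (∫ s in a..t, (g s).im) • Complex.I := by
    intro t ht
    have hgt : IntervalIntegrable g volume a t := hg.mono_set (uIcc_subset_uIcc_left ht)
    apply Complex.ext
    · have := intervalIntegral.intervalIntegral_re (𝕜 := ℂ) hgt
      simpa using this.symm
    · have := intervalIntegral.intervalIntegral_im (𝕜 := ℂ) hgt
      simpa using this.symm
  convert! H E hE hs using 1
  refine Finset.sum_congr rfl fun i hi => ?_
  rw [key _ (hE.1 i hi).1, key _ (hE.1 i hi).2]
  rfl

theorem derivWithin_integral_ae (hab : a < b) {g : ℝ → ℂ}
    (hg : IntervalIntegrable g volume a b) (c : ℂ) :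
    derivWithin (fun t => c + ∫ s in a..t, g s) (Icc a b) =ᵐ[volume.restrict (Icc a b)] g := by
  filter_upwards [ae_restrict_mem measurableSet_Icc,
    ae_restrict_of_ae hg.ae_hasDerivAt_integral] with t ht h
  have h' := (h (by rwa [uIcc_of_le hab.le]) a left_mem_uIcc).const_add c
  exact h'.hasDerivWithinAt.derivWithin (uniqueDiffOn_Icc hab t ht)

/-- Fundamental theorem of calculus for absolutely continuous complex functions. -/
theorem eq_add_integral_derivWithin (hab : a < b) {y : ℝ → ℂ}
    (hy : AbsolutelyContinuousOnInterval y a b)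
    (hy' : IntervalIntegrable (derivWithin y (Icc a b)) volume a b) {t : ℝ} (ht : t ∈ Icc a b) :
    y t = y a + ∫ s in a..t, derivWithin y (Icc a b) s := by
  -- `y` minus the primitive of its derivative is absolutely continuous with derivative `0` a.e.
  have hz := hy.sub (absolutelyContinuousOnInterval_integral_complex hy')
  obtain ⟨C, hC⟩ := hz.const_of_ae_hasDerivAt_zero (by
    have h1 := MemSobolev.ac_ae_diff hab hy
    rw [ae_restrict_iff' measurableSet_Icc] at h1
    have h2 : ∀ᵐ x : ℝ, x ≠ a ∧ x ≠ b :=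
      (Measure.ae_ne volume a).and (Measure.ae_ne volume b)
    filter_upwards [h1, h2, hy'.ae_hasDerivAt_integral] with x h1 h2 h3 hx
    have hx' : x ∈ Icc a b := by rwa [uIcc_of_le hab.le] at hx
    have hnhds : Icc a b ∈ 𝓝 x :=
      Icc_mem_nhds (lt_of_le_of_ne hx'.1 h2.1.symm) (lt_of_le_of_ne hx'.2 h2.2)
    have := ((h1 hx').hasDerivWithinAt.hasDerivAt hnhds).sub (h3 hx a left_mem_uIcc)
    simpa using this)
  rw [uIcc_of_le hab.le] at hC
  have e1 := hC t ht
  have e2 := hC a (left_mem_Icc.2 hab.le)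
  simp only [Pi.sub_apply, intervalIntegral.integral_same, sub_zero] at e1 e2
  rw [e2, ← e1]
  ring

end Primitive

/-! ### Bounded operators on Sobolev spaces -/

theorem iteratedDerivWithin_iteratedDerivWithin {y : ℝ → ℂ} {s : Set ℝ} (k i : ℕ) :
    iteratedDerivWithin i (iteratedDerivWithin k y s) s = iteratedDerivWithin (k + i) y s := by
  induction i with
  | zero => simp
  | succ i ih =>
    ext t
    rw [iteratedDerivWithin_succ, ih, ← add_assoc, iteratedDerivWithin_succ]

/-- `L_p[a,b]` embeds continuously into `L_1[a,b]`. -/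
theorem exists_integral_norm_le_eLpNorm (p : ℝ≥0∞) (hp : 1 ≤ p) (a b : ℝ) :
    ∃ K, 0 ≤ K ∧ ∀ f : ℝ → ℂ, MemLp f p (volume.restrict (Icc a b)) →
      ∫ t in Icc a b, ‖f t‖ ≤ K * (eLpNorm f p (volume.restrict (Icc a b))).toReal := by
  have hfin : (volume.restrict (Icc a b)) univ ^ (1 / (1 : ℝ≥0∞).toReal - 1 / p.toReal) ≠ ∞ := by
    refine ENNReal.rpow_ne_top_of_nonneg ?_ (measure_ne_top _ _)
    rcases eq_or_ne p ∞ with rfl | hpt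
    · simp
    · have : 1 ≤ p.toReal := by
        simpa using (ENNReal.toReal_le_toReal ENNReal.one_ne_top hpt).2 hp
      simpa using inv_le_one_of_one_le₀ this
  refine ⟨((volume.restrict (Icc a b)) univ ^ (1 / (1 : ℝ≥0∞).toReal - 1 / p.toReal)).toReal,
    ENNReal.toReal_nonneg, fun f hf => ?_⟩
  have h := eLpNorm_le_eLpNorm_mul_rpow_measure_univ hp hf.1
  rw [integral_norm_eq_lintegral_enorm hf.1, ← eLpNorm_one_eq_lintegral_enorm, mul_comm,
    ← ENNReal.toReal_mul]
  exact ENNReal.toReal_mono (ENNReal.mul_ne_top hf.2.ne hfin) h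

theorem MemSobolev.of_contDiffOn {N : ℕ} {p : ℝ≥0∞} {a b : ℝ} {y : ℝ → ℂ} (hab : a < b)
    (hy : ContDiffOn ℝ N y (Icc a b)) : MemSobolev N p a b y := by
  induction N generalizing y with
  | zero => exact MemSobolev.memLp_of_continuousOn hy.continuousOn
  | succ N ih =>
    have h := (contDiffOn_succ_iff_derivWithin (𝕜 := ℝ) (f := y) (n := (N : WithTop ℕ∞))
      (uniqueDiffOn_Icc hab)).1 (by exact_mod_cast hy)
    refine (MemSobolev.succ_iff hab).2 ⟨?_, fun _ => h.1, ih h.2.2⟩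
    apply ContDiffOn.absolutelyContinuousOnInterval
    rw [uIcc_of_le hab.le]
    exact hy.of_le (by exact_mod_cast Nat.succ_le_succ (Nat.zero_le N))

namespace SobolevSpace

variable {N M : ℕ} {p : ℝ≥0∞} {a b : ℝ} [hab : Fact (a < b)]

theorem deriv_mk (y : ℝ → ℂ) (hy : MemSobolev N p a b y) {k : ℕ} (hk : k ≤ N) :
    (mk y hy).deriv k =ᵐ[volume.restrict (Icc a b)] iteratedDerivWithin k y (Icc a b) :=
  MemSobolev.iter_congr hab.out hk (mk y hy).memSobolev_rep hy (rep_mk y hy)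

theorem deriv_zero_eq (u : SobolevSpace N p a b) : u.deriv 0 = u.rep := by simp [deriv]

theorem memSobolev_deriv {k : ℕ} (h : N + k ≤ M) (u : SobolevSpace M p a b) :
    MemSobolev N p a b (u.deriv k) := by
  obtain ⟨s, rfl⟩ := Nat.exists_eq_add_of_le h
  have h1 : MemSobolev (N + s + k) p a b u.rep := by
    convert! u.memSobolev_rep using 1
    omega
  exact MemSobolev.mono' hab.out (MemSobolev.iter hab.out h1)

/-- For positive order, a.e. equality of the representative with a continuous function on `[a,b]` is
equality at every point of `[a,b]`. -/
theorem eqOn_rep {u : SobolevSpace (N + 1) p a b} {y : ℝ → ℂ} (hy : ContinuousOn y (Icc a b))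
    (h : u.rep =ᵐ[volume.restrict (Icc a b)] y) : EqOn u.rep y (Icc a b) :=
  Measure.eqOn_Icc_of_ae_eq volume hab.out.ne h u.memSobolev_rep.continuousOn hy

theorem rep_sum {N : ℕ} {ι : Type*} (s : Finset ι) (f : ι → SobolevSpace N p a b) :
    (∑ i ∈ s, f i).rep =ᵐ[volume.restrict (Icc a b)] fun t => ∑ i ∈ s, (f i).rep t := by
  classical
  induction s using Finset.induction_on with
  | empty => simpa using! rep_smul 0 (0 : SobolevSpace N p a b)
  | insert i s hi ih =>
    rw [Finset.sum_insert hi]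
    filter_upwards [rep_add (f i) (∑ i ∈ s, f i), ih] with t h1 h2
    rw [h1, Pi.add_apply, h2, Finset.sum_insert hi]

/-- The monomial `t ^ j`, as an element of `W_p^N`. It is written as a real power times `1 : ℂ`, so that
its derivatives in the real variable are those of a real power. -/
def monomial (N : ℕ) (p : ℝ≥0∞) (a b : ℝ) [hab : Fact (a < b)] (j : ℕ) : SobolevSpace N p a b :=
  mk (fun t : ℝ => (t ^ j) • (1 : ℂ)) (MemSobolev.of_contDiffOn hab.out (by fun_prop))

theorem deriv_monomial (j : ℕ) {s : ℕ} (hs : s ≤ N) :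
    (monomial N p a b j).deriv s =ᵐ[volume.restrict (Icc a b)]
      fun t : ℝ => (j.descFactorial s * t ^ (j - s) : ℝ) • (1 : ℂ) := by
  refine (deriv_mk _ _ hs).trans ?_
  filter_upwards [ae_restrict_mem measurableSet_Icc] with t ht
  rw [iteratedDerivWithin_smul_const ht (uniqueDiffOn_Icc hab.out) (by fun_prop),
    iteratedDerivWithin_pow ht (uniqueDiffOn_Icc hab.out)]

section Norm

theorem norm_eq_eLpNorm (u : SobolevSpace 0 p a b) :
    ‖u‖ = (eLpNorm u.rep p (volume.restrict (Icc a b))).toReal := by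
  simp [norm_def, deriv_zero_eq]

theorem toReal_eLpNorm_rep_le (u : SobolevSpace N p a b) :
    (eLpNorm u.rep p (volume.restrict (Icc a b))).toReal ≤ ‖u‖ := by
  rw [norm_def, ← deriv_zero_eq]
  exact Finset.single_le_sum
    (f := fun k => (eLpNorm (u.deriv k) p (volume.restrict (Icc a b))).toReal)
    (fun _ _ => ENNReal.toReal_nonneg) (by simp)

/-- The product of `u ∈ W_p^N` and `v ∈ W_p^(N+1)`, as an element of `W_p^N`. -/
def mul (u : SobolevSpace N p a b) (v : SobolevSpace (N + 1) p a b) : SobolevSpace N p a b :=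
  mk (u.rep * v.rep) (u.memSobolev_rep.mul hab.out v.memSobolev_rep)

theorem rep_mul (u : SobolevSpace N p a b) (v : SobolevSpace (N + 1) p a b) :
    (mul u v).rep =ᵐ[volume.restrict (Icc a b)] u.rep * v.rep :=
  rep_mk _ _

variable [hp : Fact (1 ≤ p)]

/-- The differentiation operator `u ↦ u^(k)` from `W_p^M` to `W_p^N`, where `N + k ≤ M`. For `k = 0`
it is the embedding of `W_p^M` into `W_p^N`. -/
def derivL (k : ℕ) (h : N + k ≤ M) : SobolevSpace M p a b →L[ℂ] SobolevSpace N p a b :=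
  LinearMap.mkContinuous
    { toFun := fun u => mk (u.deriv k) (memSobolev_deriv h u)
      map_add' := fun u v => ext_ae (((rep_mk _ _).trans (deriv_add u v (by omega))).trans
        ((rep_add _ _).trans ((rep_mk _ _).add (rep_mk _ _))).symm)
      map_smul' := fun c u => ext_ae (((rep_mk _ _).trans (deriv_smul c u (by omega))).trans
        ((rep_smul _ _).trans ((rep_mk _ _).const_smul c)).symm) } 1 fun u => by
    rw [one_mul, LinearMap.coe_mk, AddHom.coe_mk, norm_def, norm_def]
    have h1 : ∀ i ∈ Finset.range (N + 1),
        (eLpNorm ((mk (u.deriv k) (memSobolev_deriv h u)).deriv i) p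
          (volume.restrict (Icc a b))).toReal =
        (eLpNorm (u.deriv (i + k)) p (volume.restrict (Icc a b))).toReal := fun i hi => by
      rw [eLpNorm_congr_ae (deriv_mk _ _ (Nat.lt_succ_iff.1 (Finset.mem_range.1 hi)))]
      simp only [deriv, iteratedDerivWithin_iteratedDerivWithin, add_comm]
    rw [Finset.sum_congr rfl h1, Finset.range_eq_Ico, Finset.range_eq_Ico,
      Finset.sum_Ico_add' (fun i => (eLpNorm (u.deriv i) p (volume.restrict (Icc a b))).toReal)]
    exact Finset.sum_le_sum_of_subset_of_nonneg (Finset.Ico_subset_Ico (by omega) (by omega))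
      fun _ _ _ => ENNReal.toReal_nonneg

theorem rep_derivL {k : ℕ} (h : N + k ≤ M) (u : SobolevSpace M p a b) :
    (derivL k h u).rep =ᵐ[volume.restrict (Icc a b)] u.deriv k :=
  rep_mk _ (memSobolev_deriv h u)

theorem deriv_derivL {k i : ℕ} (h : N + k ≤ M) (hi : i ≤ N) (u : SobolevSpace M p a b) :
    (derivL k h u).deriv i =ᵐ[volume.restrict (Icc a b)] u.deriv (k + i) := by
  have := deriv_mk _ (memSobolev_deriv h u) hi
  simp only [deriv, iteratedDerivWithin_iteratedDerivWithin] at this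
  exact this

theorem norm_derivL_le {k : ℕ} (h : N + k ≤ M) (u : SobolevSpace M p a b) :
    ‖derivL k h u‖ ≤ ‖u‖ :=
  ((derivL k h).le_of_opNorm_le (LinearMap.mkContinuous_norm_le _ zero_le_one _) u).trans_eq
    (one_mul _)

theorem norm_eq_add_norm_derivL (u : SobolevSpace (N + 1) p a b) :
    ‖u‖ = (eLpNorm u.rep p (volume.restrict (Icc a b))).toReal + ‖derivL 1 le_rfl u‖ := by
  rw [norm_def, Finset.sum_range_succ', norm_def, add_comm, deriv_zero_eq]
  congr 1
  refine Finset.sum_congr rfl fun i hi => ?_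
  rw [eLpNorm_congr_ae (deriv_derivL (k := 1) le_rfl
    (Nat.lt_succ_iff.1 (Finset.mem_range.1 hi)) u), add_comm 1 i]

theorem intervalIntegrable_of_memLp {f : ℝ → ℂ} (hf : MemLp f p (volume.restrict (Icc a b))) :
    IntervalIntegrable f volume a b := by
  rw [intervalIntegrable_iff_integrableOn_Icc_of_le hab.out.le]
  exact hf.integrable hp.out

/-- Oscillation bound: `‖u(t)‖ ≤ ‖u(s)‖ + K ‖u'‖_p`. -/
theorem exists_norm_rep_le_add (N : ℕ) (p : ℝ≥0∞) [hp : Fact (1 ≤ p)] (a b : ℝ)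
    [hab : Fact (a < b)] : ∃ K, 0 ≤ K ∧ ∀ u : SobolevSpace (N + 1) p a b, ∀ s ∈ Icc a b,
      ∀ t ∈ Icc a b, ‖u.rep t‖ ≤ ‖u.rep s‖ + K * ‖derivL (N := N) 1 le_rfl u‖ := by
  obtain ⟨K, hK, H⟩ := exists_integral_norm_le_eLpNorm p hp.out a b
  refine ⟨K, hK, fun u s hs t ht => ?_⟩
  obtain ⟨hac, -, hd⟩ := (MemSobolev.succ_iff hab.out).1 u.memSobolev_rep
  have hLp := hd.memLp hab.out
  have hint := intervalIntegrable_of_memLp hLp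
  have hsub : u.rep t = u.rep s + ∫ x in s..t, derivWithin u.rep (Icc a b) x := by
    have hmem : ∀ x ∈ Icc a b, IntervalIntegrable (derivWithin u.rep (Icc a b)) volume a x :=
      fun x hx => hint.mono_set (uIcc_subset_uIcc_left (by rwa [uIcc_of_le hab.out.le]))
    rw [eq_add_integral_derivWithin hab.out hac hint ht,
      eq_add_integral_derivWithin hab.out hac hint hs,
      ← intervalIntegral.integral_interval_sub_left (hmem t ht) (hmem s hs)]
    ring
  have hle : ‖∫ x in s..t, derivWithin u.rep (Icc a b) x‖ ≤
      ∫ x in Icc a b, ‖derivWithin u.rep (Icc a b) x‖ := by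
    refine intervalIntegral.norm_integral_le_integral_norm_uIoc.trans
      (setIntegral_mono_set (hLp.integrable hp.out).norm
        (Eventually.of_forall fun _ => norm_nonneg _) (LE.le.eventuallyLE ?_))
    intro x hx
    exact ⟨(le_min hs.1 ht.1).trans hx.1.le, hx.2.trans (max_le hs.2 ht.2)⟩
  have hnorm : (eLpNorm (derivWithin u.rep (Icc a b)) p (volume.restrict (Icc a b))).toReal ≤
      ‖derivL (N := N) 1 le_rfl u‖ := by
    refine le_trans (le_of_eq ?_) (toReal_eLpNorm_rep_le _)
    rw [eLpNorm_congr_ae (rep_derivL _ u)]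
    simp only [deriv, iteratedDerivWithin_one]
  rw [hsub]
  exact (norm_add_le _ _).trans (add_le_add_right
    (hle.trans ((H _ hLp).trans (mul_le_mul_of_nonneg_left hnorm hK))) _)

/-- The embedding of `W_p^(N+1)` into `C[a,b]` is bounded. -/
theorem exists_norm_rep_le (N : ℕ) (p : ℝ≥0∞) [hp : Fact (1 ≤ p)] (a b : ℝ)
    [hab : Fact (a < b)] : ∃ C, 0 ≤ C ∧ ∀ u : SobolevSpace (N + 1) p a b,
      ∀ t ∈ Icc a b, ‖u.rep t‖ ≤ C * ‖u‖ := by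
  obtain ⟨K, hK, H⟩ := exists_integral_norm_le_eLpNorm p hp.out a b
  obtain ⟨K', hK', H'⟩ := exists_norm_rep_le_add N p a b
  have hba : 0 < b - a := sub_pos.2 hab.out
  refine ⟨(b - a)⁻¹ * K + K', by positivity, fun u t ht => ?_⟩
  have hu := u.memSobolev_rep.memLp hab.out
  -- The oscillation bound, averaged over the base point `s`.
  have hmono : ∫ _ in Icc a b, ‖u.rep t‖ ≤
      ∫ s in Icc a b, (‖u.rep s‖ + K' * ‖derivL (N := N) 1 le_rfl u‖) :=
    setIntegral_mono_on (integrable_const _)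
      ((hu.integrable hp.out).norm.add (integrable_const _)) measurableSet_Icc
      fun s hs => H' u s hs t ht
  rw [integral_add (hu.integrable hp.out).norm (integrable_const _)] at hmono
  simp only [integral_const, measureReal_restrict_apply_univ, Real.volume_real_Icc,
    max_eq_left hba.le, smul_eq_mul] at hmono
  have h1 := (H _ hu).trans (mul_le_mul_of_nonneg_left (toReal_eLpNorm_rep_le u) hK)
  have h2 := mul_le_mul_of_nonneg_left (norm_derivL_le (N := N) (k := 1) le_rfl u) hK'
  have h3 : ‖u.rep t‖ ≤ (b - a)⁻¹ * (∫ s in Icc a b, ‖u.rep s‖) +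
      K' * ‖derivL (N := N) 1 le_rfl u‖ := by
    rw [← mul_le_mul_iff_right₀ hba, mul_add, mul_inv_cancel_left₀ hba.ne']
    exact hmono
  calc ‖u.rep t‖ ≤ _ := h3
    _ ≤ (b - a)⁻¹ * (K * ‖u‖) + K' * ‖u‖ :=
        add_le_add (mul_le_mul_of_nonneg_left h1 (by positivity)) h2
    _ = _ := by ring

/-- The value at the left endpoint, as a continuous functional on `W_p^(N+1)`. -/
def evalLeft (N : ℕ) (p : ℝ≥0∞) [Fact (1 ≤ p)] (a b : ℝ) [hab : Fact (a < b)] :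
    SobolevSpace (N + 1) p a b →L[ℂ] ℂ :=
  LinearMap.mkContinuousOfExistsBound
    { toFun := fun u => u.rep a
      map_add' := fun u v => eqOn_rep
        (u.memSobolev_rep.continuousOn.add v.memSobolev_rep.continuousOn) (rep_add u v)
        (left_mem_Icc.2 hab.out.le)
      map_smul' := fun c u => eqOn_rep (u.memSobolev_rep.continuousOn.const_smul c)
        (rep_smul c u) (left_mem_Icc.2 hab.out.le) }
    ((exists_norm_rep_le N p a b).imp fun _ hC u => hC.2 u a (left_mem_Icc.2 hab.out.le))

/-! ### Completeness of Sobolev spaces -/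

/-- `c + ∫_a^t g` is in `W_p^(N+1)` for `g ∈ W_p^N`; for `N ≥ 1` its derivative is `g` everywhere on
`[a,b]`, for `N = 0` almost everywhere. -/
theorem memSobolev_primitive (c : ℂ) (g : SobolevSpace N p a b) :
    MemSobolev (N + 1) p a b (fun t => c + ∫ s in a..t, g.rep s) := by
  have hint := intervalIntegrable_of_memLp (g.memSobolev_rep.memLp hab.out)
  have hder : 0 < N → ∀ t ∈ Icc a b,
      HasDerivWithinAt (fun t => c + ∫ s in a..t, g.rep s) (g.rep t) (Icc a b) t := by
    intro hN t ht
    obtain ⟨N, rfl⟩ := Nat.exists_eq_succ_of_ne_zero hN.ne'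
    have hc := g.memSobolev_rep.continuousOn
    have := Fact.mk ht
    refine HasDerivWithinAt.const_add c (intervalIntegral.integral_hasDerivWithinAt_right
      (hint.mono_set (uIcc_subset_uIcc_left (by rwa [uIcc_of_le hab.out.le]))) ?_ (hc t ht))
    exact hc.stronglyMeasurableAtFilter_nhdsWithin measurableSet_Icc t
  refine (MemSobolev.succ_iff hab.out).2 ⟨?_, fun hN t ht =>
    (hder hN t ht).differentiableWithinAt, ?_⟩
  · exact (contDiffOn_const (c := c)).absolutelyContinuousOnInterval.add
      (absolutelyContinuousOnInterval_integral_complex hint)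
  · refine g.memSobolev_rep.congr hab.out (derivWithin_integral_ae hab.out hint c).symm
      fun hN t ht => ?_
    exact ((hder hN t ht).derivWithin (uniqueDiffOn_Icc hab.out t ht)).symm

theorem surjective_evalLeft_prod_derivL :
    Function.Surjective ((evalLeft N p a b).prod (derivL (N := N) 1 le_rfl)) := by
  rintro ⟨c, g⟩
  have hy := memSobolev_primitive c g
  refine ⟨mk _ hy, Prod.ext ?_ (ext_ae ?_)⟩
  · change (mk _ hy).rep a = c
    rw [eqOn_rep hy.continuousOn (rep_mk _ hy) (left_mem_Icc.2 hab.out.le)]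
    simp
  · refine (rep_derivL le_rfl _).trans ((deriv_mk _ hy (by omega)).trans ?_)
    rw [iteratedDerivWithin_one]
    exact derivWithin_integral_ae hab.out
      (intervalIntegrable_of_memLp (g.memSobolev_rep.memLp hab.out)) c

/-- The map `u ↦ (u(a), u')` is bounded below, since `‖u‖_p` is controlled by the supremum of `u`,
which is at most `‖u(a)‖ + K ‖u'‖_p`. -/
theorem exists_norm_le_evalLeft_prod_derivL (N : ℕ) (p : ℝ≥0∞) [hp : Fact (1 ≤ p)] (a b : ℝ)
    [hab : Fact (a < b)] : ∃ C : NNReal, ∀ u : SobolevSpace (N + 1) p a b,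
      ‖u‖ ≤ C * ‖((evalLeft N p a b).prod (derivL (N := N) 1 le_rfl)) u‖ := by
  obtain ⟨K, hK, H⟩ := exists_norm_rep_le_add N p a b
  set V := ((volume.restrict (Icc a b)) univ ^ p.toReal⁻¹).toReal
  have hV0 : 0 ≤ V := ENNReal.toReal_nonneg
  refine ⟨NNReal.mk (V * (1 + K) + 1) (by positivity), fun u => ?_⟩
  set w := ((evalLeft N p a b).prod (derivL (N := N) 1 le_rfl)) u
  have h1 : ‖u.rep a‖ ≤ ‖w‖ := norm_fst_le w
  have h2 : ‖derivL (N := N) 1 le_rfl u‖ ≤ ‖w‖ := norm_snd_le w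
  have h3 : ∀ t ∈ Icc a b, ‖u.rep t‖ ≤ (1 + K) * ‖w‖ := fun t ht =>
    (H u a (left_mem_Icc.2 hab.out.le) t ht).trans (by nlinarith)
  have h4 : (eLpNorm u.rep p (volume.restrict (Icc a b))).toReal ≤ V * ((1 + K) * ‖w‖) := by
    have := eLpNorm_le_of_ae_bound (p := p) (μ := volume.restrict (Icc a b)) (f := u.rep)
      (C := (1 + K) * ‖w‖) ((ae_restrict_mem measurableSet_Icc).mono h3)
    have hfin : (volume.restrict (Icc a b)) univ ^ p.toReal⁻¹ ≠ ∞ :=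
      ENNReal.rpow_ne_top_of_nonneg (by positivity) (measure_ne_top _ _)
    have := ENNReal.toReal_mono (ENNReal.mul_ne_top hfin ENNReal.ofReal_ne_top) this
    rwa [ENNReal.toReal_mul, ENNReal.toReal_ofReal (by positivity)] at this
  rw [norm_eq_add_norm_derivL, NNReal.coe_mk]
  calc _ ≤ V * ((1 + K) * ‖w‖) + ‖w‖ := add_le_add h4 h2
    _ = _ := by ring

/-- `W_p^0` is `L_p`, and `u ↦ (u(a), u')` identifies `W_p^(N+1)` with `ℂ × W_p^N`. -/
instance : CompleteSpace (SobolevSpace N p a b) := by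
  induction N with
  | zero =>
    let f : SobolevSpace 0 p a b →ₗ[ℂ] Lp ℂ p (volume.restrict (Icc a b)) :=
      (sobolevSubmodule 0 p a b).subtype
    have hf : Isometry f := AddMonoidHomClass.isometry_of_norm f fun u => by
      change ‖u.toLp‖ = ‖u‖
      rw [Lp.norm_def, norm_eq_eLpNorm, eLpNorm_congr_ae u.toLp_ae_eq_rep]
    refine (hf.isUniformInducing.completeSpace_congr fun u => ?_).2 inferInstance
    exact ⟨⟨u, u, Lp.memLp u, EventuallyEq.rfl⟩, rfl⟩
  | succ N ih =>
    obtain ⟨C, hC⟩ := exists_norm_le_evalLeft_prod_derivL N p a b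
    have hf := ((evalLeft N p a b).prod
      (derivL (N := N) (p := p) (a := a) (b := b) 1 le_rfl)).antilipschitz_of_bound hC
    exact ((hf.isUniformInducing (ContinuousLinearMap.uniformContinuous _)).completeSpace_congr
      surjective_evalLeft_prod_derivL).2 inferInstance

/-! ### The product `W_p^N × W_p^(N+1) → W_p^N` -/

/-- Leibniz rule. -/
theorem derivL_mul (u : SobolevSpace (N + 1) p a b) (v : SobolevSpace (N + 2) p a b) :
    derivL 1 le_rfl (mul u v) = mul (derivL 1 le_rfl u) (derivL 0 (by omega) v) +
      mul (derivL 0 (by omega) u) (derivL 1 le_rfl v) := by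
  refine ext_ae ?_
  have hv := (MemSobolev.succ_iff hab.out).1 v.memSobolev_rep
  have hu := (MemSobolev.succ_iff hab.out).1 u.memSobolev_rep
  have h1 := deriv_mk _ (u.memSobolev_rep.mul hab.out v.memSobolev_rep) (k := 1) (by omega)
  filter_upwards [ae_restrict_mem measurableSet_Icc, MemSobolev.ac_ae_diff hab.out hu.1, h1,
    rep_derivL (N := N) (k := 1) le_rfl (mul u v), rep_add
      (mul (derivL (N := N) 1 le_rfl u) (derivL (N := N + 1) 0 (by omega) v))
      (mul (derivL (N := N) 0 (by omega) u) (derivL (N := N + 1) 1 le_rfl v)),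
    rep_mul (derivL (N := N) 1 le_rfl u) (derivL (N := N + 1) 0 (by omega) v),
    rep_mul (derivL (N := N) 0 (by omega) u) (derivL (N := N + 1) 1 le_rfl v),
    rep_derivL (N := N) (k := 1) le_rfl u, rep_derivL (N := N) (k := 0) (by omega) u,
    rep_derivL (N := N + 1) (k := 1) le_rfl v, rep_derivL (N := N + 1) (k := 0) (by omega) v]
    with t ht hd h1 h2 h3 h4 h5 h6 h7 h8 h9
  rw [h2, h3, Pi.add_apply, h4, h5, Pi.mul_apply, Pi.mul_apply, h6, h7, h8, h9]
  refine h1.trans ?_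
  simp only [deriv, iteratedDerivWithin_one, iteratedDerivWithin_zero]
  exact derivWithin_mul hd (hv.2.1 N.succ_pos t ht)

/-- Boundedness of the product, by induction on `N` through the Leibniz rule; the `L_p` norm of `u v`
is at most `‖u‖_p` times the supremum of `v`. -/
theorem exists_norm_mul_le (N : ℕ) (p : ℝ≥0∞) [hp : Fact (1 ≤ p)] (a b : ℝ)
    [hab : Fact (a < b)] : ∃ C, 0 ≤ C ∧ ∀ (u : SobolevSpace N p a b)
      (v : SobolevSpace (N + 1) p a b), ‖mul u v‖ ≤ C * ‖u‖ * ‖v‖ := by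
  have hbase : ∀ N : ℕ, ∃ C, 0 ≤ C ∧ ∀ (u : SobolevSpace N p a b)
      (v : SobolevSpace (N + 1) p a b),
      (eLpNorm (mul u v).rep p (volume.restrict (Icc a b))).toReal ≤ C * ‖u‖ * ‖v‖ := by
    intro N
    obtain ⟨C, hC, H⟩ := exists_norm_rep_le N p a b
    refine ⟨C, hC, fun u v => ?_⟩
    have h := eLpNorm_le_mul_eLpNorm_of_ae_le_mul (μ := volume.restrict (Icc a b))
      (f := u.rep * v.rep) (g := u.rep) (c := C * ‖v‖) ((ae_restrict_mem measurableSet_Icc).mono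
        fun t ht => by
          rw [Pi.mul_apply, norm_mul, mul_comm]
          exact mul_le_mul_of_nonneg_right (H v t ht) (norm_nonneg _)) p
    rw [eLpNorm_congr_ae (rep_mul u v)]
    refine (ENNReal.toReal_mono (ENNReal.mul_ne_top ENNReal.ofReal_ne_top
      (u.memSobolev_rep.memLp hab.out).2.ne) h).trans ?_
    rw [ENNReal.toReal_mul, ENNReal.toReal_ofReal (by positivity)]
    calc _ ≤ C * ‖v‖ * ‖u‖ :=
          mul_le_mul_of_nonneg_left (toReal_eLpNorm_rep_le u) (by positivity)
      _ = _ := by ring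
  induction N with
  | zero =>
    obtain ⟨C, hC, H⟩ := hbase 0
    exact ⟨C, hC, fun u v => (norm_eq_eLpNorm _).trans_le (H u v)⟩
  | succ N ih =>
    obtain ⟨C, hC, H⟩ := hbase (N + 1)
    obtain ⟨C', hC', H'⟩ := ih
    refine ⟨C + (C' + C'), by positivity, fun u v => ?_⟩
    have hmono : ∀ (u₁ : SobolevSpace N p a b) (v₁ : SobolevSpace (N + 1) p a b),
        ‖u₁‖ ≤ ‖u‖ → ‖v₁‖ ≤ ‖v‖ → ‖mul u₁ v₁‖ ≤ C' * ‖u‖ * ‖v‖ := fun u₁ v₁ h₁ h₂ =>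
      (H' u₁ v₁).trans (by gcongr)
    rw [norm_eq_add_norm_derivL, derivL_mul]
    calc _ ≤ C * ‖u‖ * ‖v‖ + (C' * ‖u‖ * ‖v‖ + C' * ‖u‖ * ‖v‖) :=
          add_le_add (H u v) ((norm_add_le _ _).trans (add_le_add
            (hmono _ _ (norm_derivL_le _ u) (norm_derivL_le _ v))
            (hmono _ _ (norm_derivL_le _ u) (norm_derivL_le _ v))))
      _ = _ := by ring

/-- `SobolevSpace.mul` as a bounded bilinear map. -/
def mulL (N : ℕ) (p : ℝ≥0∞) [Fact (1 ≤ p)] (a b : ℝ) [hab : Fact (a < b)] :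
    SobolevSpace N p a b →L[ℂ] SobolevSpace (N + 1) p a b →L[ℂ] SobolevSpace N p a b :=
  LinearMap.mkContinuous₂
    (LinearMap.mk₂ ℂ mul
      (fun u u' v => ext_ae <| by
        filter_upwards [rep_mul (u + u') v, rep_add (mul u v) (mul u' v), rep_mul u v,
          rep_mul u' v, rep_add u u'] with t h1 h2 h3 h4 h5
        simp [h1, h2, h3, h4, h5, add_mul])
      (fun c u v => ext_ae <| by
        filter_upwards [rep_mul (c • u) v, rep_smul c (mul u v), rep_mul u v,
          rep_smul c u] with t h1 h2 h3 h4
        simp [h1, h2, h3, h4, mul_assoc])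
      (fun u v v' => ext_ae <| by
        filter_upwards [rep_mul u (v + v'), rep_add (mul u v) (mul u v'), rep_mul u v,
          rep_mul u v', rep_add v v'] with t h1 h2 h3 h4 h5
        simp [h1, h2, h3, h4, h5, mul_add])
      (fun c u v => ext_ae <| by
        filter_upwards [rep_mul u (c • v), rep_smul c (mul u v), rep_mul u v,
          rep_smul c v] with t h1 h2 h3 h4
        simp [h1, h2, h3, h4, mul_left_comm]))
    (exists_norm_mul_le N p a b).choose (exists_norm_mul_le N p a b).choose_spec.2

theorem rep_mulL (u : SobolevSpace N p a b) (v : SobolevSpace (N + 1) p a b) :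
    (mulL N p a b u v).rep =ᵐ[volume.restrict (Icc a b)] u.rep * v.rep :=
  rep_mul u v

end Norm

end SobolevSpace

/-! ### The differential operator and its dependence on the coefficients -/

section DiffOp

open SobolevSpace

variable {n r m : ℕ} {p : ℝ≥0∞} {a b : ℝ} [hab : Fact (a < b)] [hp : Fact (1 ≤ p)]

/-- The operator `diffOp A` as a continuous linear map, assembled from the differentiation operators
and the bounded bilinear product `W_p^n × W_p^(n+1) → W_p^n`. -/
def diffOpL (A : Fin r → Matrix (Fin m) (Fin m) (SobolevSpace n p a b)) :
    SobolevVec (n + r) p a b m →L[ℂ] SobolevVec n p a b m :=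
  ((PiLp.continuousLinearEquiv 1 ℂ fun _ : Fin m => SobolevSpace n p a b).symm :
      (Fin m → SobolevSpace n p a b) →L[ℂ] SobolevVec n p a b m) ∘L
    ∑ i, ContinuousLinearMap.single ℂ (fun _ : Fin m => SobolevSpace n p a b) i ∘L
      (derivL r le_rfl ∘L PiLp.proj 1 (fun _ : Fin m => SobolevSpace (n + r) p a b) i +
        ∑ j : Fin r, ∑ q : Fin m, mulL n p a b (A j i q) ∘L
          (derivL j (by omega) ∘L PiLp.proj 1 (fun _ : Fin m => SobolevSpace (n + r) p a b) q))

theorem diffOpL_apply (A : Fin r → Matrix (Fin m) (Fin m) (SobolevSpace n p a b))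
    (y : SobolevVec (n + r) p a b m) (i : Fin m) :
    diffOpL A y i = derivL r le_rfl (y i) +
      ∑ j : Fin r, ∑ q : Fin m, mulL n p a b (A j i q) (derivL j (by omega) (y q)) := by
  simp [diffOpL, Finset.sum_apply, Pi.single_apply, Finset.sum_add_distrib]

theorem coe_diffOpL (A : Fin r → Matrix (Fin m) (Fin m) (SobolevSpace n p a b)) :
    (diffOpL A : SobolevVec (n + r) p a b m →ₗ[ℂ] SobolevVec n p a b m) = diffOp A := by
  ext y i
  change diffOpL A y i = mk (diffExpr A y i) (memSobolev_diffExpr A y i)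
  rw [diffOpL_apply]
  refine ext_ae ?_
  have h1 : ∀ᵐ t ∂(volume.restrict (Icc a b)), ∀ (j : Fin r) (q : Fin m),
      (mulL n p a b (A j i q) (derivL j (by omega) (y q))).rep t =
        (A j i q).rep t * (y q).deriv j t := ae_all_iff.2 fun j => ae_all_iff.2 fun q => by
    filter_upwards [rep_mulL (A j i q) (derivL (N := n + 1) j (by omega) (y q)),
      rep_derivL (N := n + 1) (k := j) (by omega) (y q)] with t h1 h2
    rw [h1, Pi.mul_apply, h2]
  have h2 : ∀ᵐ t ∂(volume.restrict (Icc a b)), ∀ (j : Fin r),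
      (∑ q : Fin m, mulL n p a b (A j i q) (derivL j (by omega) (y q))).rep t =
        ∑ q : Fin m, (mulL n p a b (A j i q) (derivL j (by omega) (y q))).rep t :=
    ae_all_iff.2 fun j => rep_sum _ _
  filter_upwards [h1, h2, rep_mk _ (memSobolev_diffExpr A y i),
    rep_derivL (N := n) (k := r) le_rfl (y i), rep_add (derivL (N := n) r le_rfl (y i))
      (∑ j : Fin r, ∑ q : Fin m, mulL n p a b (A j i q) (derivL j (by omega) (y q))),
    rep_sum Finset.univ fun j : Fin r =>
      ∑ q : Fin m, mulL n p a b (A j i q) (derivL j (by omega) (y q))] with t h1 h2 h3 h4 h5 h6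
  rw [h3, h5, Pi.add_apply, h4, h6, diffExpr]
  simp only [h2, h1]

theorem continuous_diffOpL : Continuous
    (diffOpL : (Fin r → Matrix (Fin m) (Fin m) (SobolevSpace n p a b)) → _) := by
  unfold diffOpL
  refine continuous_const.clm_comp (continuous_finsetSum _ fun i _ => continuous_const.clm_comp
    (continuous_const.add (continuous_finsetSum _ fun j _ => continuous_finsetSum _ fun q _ =>
      Continuous.clm_comp ?_ continuous_const)))
  exact (mulL n p a b).continuous.comp (by fun_prop)

/-! ### Recovering the coefficients from monomial test functions -/

theorem derivL_monomial_of_lt {N M j s : ℕ} (h : N + s ≤ M) (hjs : j < s) :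
    derivL s h (monomial M p a b j) = (0 : SobolevSpace N p a b) := by
  have h0 : (0 : SobolevSpace N p a b).rep =ᵐ[volume.restrict (Icc a b)] 0 := by
    simpa using rep_smul 0 (0 : SobolevSpace N p a b)
  refine ext_ae (((rep_derivL h _).trans (deriv_monomial j (by omega))).trans
    (EventuallyEq.trans ?_ h0.symm))
  rw [Nat.descFactorial_eq_zero_iff_lt.2 hjs]
  exact Eventually.of_forall fun t => by simp

theorem mulL_derivL_monomial {N M j : ℕ} (h : N + 1 + j ≤ M) (u : SobolevSpace N p a b) :
    mulL N p a b u (derivL j h (monomial M p a b j)) = (j.factorial : ℂ) • u := by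
  refine ext_ae ?_
  filter_upwards [rep_mulL u (derivL j h (monomial M p a b j)), rep_smul (j.factorial : ℂ) u,
    rep_derivL h (monomial M p a b j), deriv_monomial (N := M) (p := p) (a := a) (b := b) j
      (s := j) (by omega)] with t h1 h2 h3 h4
  rw [h1, Pi.mul_apply, h3, h4, h2, Pi.smul_apply]
  simp [Nat.descFactorial_self, mul_comm]

theorem diffOpL_single_apply (A : Fin r → Matrix (Fin m) (Fin m) (SobolevSpace n p a b))
    (i q : Fin m) (u : SobolevSpace (n + r) p a b) :
    diffOpL A (PiLp.single 1 q u) i = derivL r le_rfl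
        ((PiLp.single 1 q u : SobolevVec (n + r) p a b m) i) +
      ∑ j : Fin r, mulL n p a b (A j i q) (derivL j (by omega) u) := by
  rw [diffOpL_apply]
  congr 1
  refine Finset.sum_congr rfl fun j _ => ?_
  rw [Finset.sum_eq_single q]
  · simp
  · intro q' _ hq
    rw [PiLp.single_eq_of_ne 1 hq, map_zero, map_zero]
  · simp

/-- Strong convergence of the differential operators forces convergence of the coefficients. Applied
to `t ^ j` in the `q`-th component, the operator gives `j! A_j` plus terms with `A_s`, `s < j`. -/
theorem tendsto_coeff_of_tendsto_diffOpL
    {A : Fin r → Matrix (Fin m) (Fin m) (SobolevSpace n p a b)}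
    {Ak : ℕ → Fin r → Matrix (Fin m) (Fin m) (SobolevSpace n p a b)}
    (h : ∀ y, Tendsto (fun k => diffOpL (Ak k) y) atTop (𝓝 (diffOpL A y))) :
    Tendsto Ak atTop (𝓝 A) := by
  suffices H : ∀ i q, ∀ j : Fin r, Tendsto (fun k => Ak k j i q) atTop (𝓝 (A j i q)) from
    tendsto_pi_nhds.2 fun j => tendsto_pi_nhds.2 fun i => tendsto_pi_nhds.2 fun q => H i q j
  intro i q j
  induction j using WellFoundedLT.induction with
  | ind j ih =>
    set P := monomial (n + r) p a b j
    have h1 : Tendsto (fun k => ∑ s : Fin r, mulL n p a b (Ak k s i q) (derivL s (by omega) P))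
        atTop (𝓝 (∑ s : Fin r, mulL n p a b (A s i q) (derivL s (by omega) P))) := by
      have := ((PiLp.proj (𝕜 := ℂ) 1 (fun _ : Fin m => SobolevSpace n p a b)
        i).continuous.tendsto _).comp (h (PiLp.single 1 q P))
      simp only [Function.comp_def, PiLp.proj_apply, diffOpL_single_apply] at this
      simpa using this.sub_const (derivL (N := n) r le_rfl
        ((PiLp.single 1 q P : SobolevVec (n + r) p a b m) i))
    have h2 : Tendsto (fun k => ∑ s ∈ Finset.univ.erase j,
          mulL n p a b (Ak k s i q) (derivL s (by omega) P))
        atTop (𝓝 (∑ s ∈ Finset.univ.erase j,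
          mulL n p a b (A s i q) (derivL s (by omega) P))) := by
      refine tendsto_finsetSum _ fun s hs => ?_
      rcases lt_or_gt_of_ne (Finset.ne_of_mem_erase hs) with hsj | hsj
      -- Coefficients of lower order converge by induction; those of higher order meet the zero
      -- derivative of `t ^ j`.
      · exact (((mulL n p a b).flip (derivL s (by omega) P)).continuous.tendsto _).comp (ih s hsj)
      · rw [derivL_monomial_of_lt _ (Fin.lt_def.1 hsj)]
        simp
    have h3 := h1.sub h2
    simp only [← Finset.add_sum_erase Finset.univ _ (Finset.mem_univ j), add_sub_cancel_right,
      P, mulL_derivL_monomial] at h3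
    have hj : ((j : ℕ).factorial : ℂ) ≠ 0 := by exact_mod_cast (Nat.factorial_ne_zero _)
    simpa [inv_smul_smul₀ hj] using h3.const_smul ((j : ℕ).factorial : ℂ)⁻¹

end DiffOp

end

/-! ### Boundary-value problems -/

theorem corollary2 (a b : ℝ) [Fact (a < b)] (p : ℝ≥0∞) [Fact (1 ≤ p)] (n r m l : ℕ)
    (hr : 1 ≤ r) (hm : 1 ≤ m) (hl : 1 ≤ l)
    (A : Fin r → Matrix (Fin m) (Fin m) (SobolevSpace n p a b))
    (B : SobolevVec (n + r) p a b m →L[ℂ] EuclideanSpace ℂ (Fin l))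
    (Ak : ℕ → Fin r → Matrix (Fin m) (Fin m) (SobolevSpace n p a b))
    (Bk : ℕ → SobolevVec (n + r) p a b m →L[ℂ] EuclideanSpace ℂ (Fin l))
    (hconv : StronglyConverges (fun k => bvpOp (Ak k) (Bk k)) (bvpOp A B))
    (hinv : IsBoundedlyInvertible (bvpOp A B)) :
    ∀ᶠ k in atTop, IsBoundedlyInvertible (bvpOp (Ak k) (Bk k)) := by
  have hcoe : ∀ A' B', bvpOp (n := n) (r := r) (m := m) (l := l) (p := p) (a := a) (b := b) A' B' =
      ((diffOpL A').prod B' : SobolevVec (n + r) p a b m →ₗ[ℂ] _) := fun A' B' => by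
    rw [bvpOp, ← coe_diffOpL]
    rfl
  simp only [hcoe] at hconv hinv ⊢
  obtain ⟨e, he⟩ := hinv
  have hL : Tendsto (fun k => diffOpL (Ak k)) atTop (𝓝 (diffOpL A)) :=
    (continuous_diffOpL.tendsto A).comp
      (tendsto_coeff_of_tendsto_diffOpL fun y => (continuous_fst.tendsto _).comp (hconv y))
  exact eventually_isBoundedlyInvertible_prod hL
    (fun y => (continuous_snd.tendsto _).comp (hconv y)) e (ContinuousLinearMap.ext he)
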